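/- Let $F$ be a field of characteristic $2$, let $V$ be a $2n$-dimensional vector space over $F$ ($n\ge 0$), and let $q:V\to F$ be a quadratic form whose polar form $\mathfrak b_q(u,v)=q(u+v)-q(u)-q(v)$ is nondegenerate. Let $\tau$ be an isometry of $(V,q)$ with $\tau^2=\mathrm{id}$, and suppose that its residual space $r(\tau)=\{\tau(x)-x : x\in V\}$ equals its fixed space $k(\tau)=\{x\in V : \tau(x)=x\}$. Let $\omega_\tau$ be the Wall form of $\tau$, i.e. the bilinear form on $r(\tau)$ with $\omega_\tau(\tau(x)-x,\tau(y)-y)=\mathfrak b_q(\tau(x)-x,y)$ for $x,y\in V$. Let $J_\tau$ be the involution ($F$-linear anti-automorphism of square $\mathrm{id}$) of the Clifford algebra $C(q)$ with $J_\tau(v)=\tau(v)$ for all $v\in V$. Write $\mathbb H_{-1}$ for the hyperbolic plane, i.e. the bilinear form with a basis $u,v$ such that $\mathfrak b(u,u)=\mathfrak b(v,v)=0$ and $\mathfrak b(u,v)=-\mathfrak b(v,u)=1$; write $\langle 1\rangle$ for the one-dimensional form $(x,y)\mapsto xy$; and write $r\mathfrak b$ for the orthogonal sum of $r$ copies of $\mathfrak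 b$. Then the following conditions are equivalent: 1. $(C(q),J_\tau)\simeq (M_{2^n}(F),t)$ as $F$-algebras with involution, where $t$ is the transpose involution; 2. $q(x)$ is a square in $F$ for every $x\in r(\tau)$; 3. $\omega_\tau(x,x)$ is a square in $F$ for every $x\in r(\tau)$; 4. either $n$ is even and $\omega_\tau\simeq \frac n2\,\mathbb H_{-1}$, or $\omega_\tau\simeq n\langle 1\rangle$. -/

import Mathlib

noncomputable section

namespace WallForm

variable {F : Type*} [Field F]

section Isometries

variable {V : Type*} [AddCommGroup V] [Module F V] {q : QuadraticForm F V}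

/-- `(V, q)` is a quadratic space: the polar form `b_q(u,v) = q(u+v) - q(u) - q(v)` is
nondegenerate, i.e. `V ∩ V^⊥ = 0`. -/
def IsQuadraticSpace (q : QuadraticForm F V) : Prop :=
  ∀ x : V, (∀ y : V, QuadraticMap.polar q x y = 0) → x = 0

/-- The linear map `x ↦ τ x - x`. -/
def subId (τ : q.IsometryEquiv q) : V →ₗ[F] V :=
  (τ.toLinearEquiv : V →ₗ[F] V) - LinearMap.id

@[simp] theorem subId_apply (τ : q.IsometryEquiv q) (x : V) : subId τ x = τ x - x := rfl

/-- The fixed space `{x | τ x = x}`. -/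
def fixedSpace (τ : q.IsometryEquiv q) : Submodule F V where
  carrier := {x | τ x = x}
  add_mem' {x y} hx hy := by
    simp_all
  zero_mem' := by
    simp
  smul_mem' a x hx := by
    simp_all

/-- The residual space `{τ x - x | x ∈ V}`. -/
abbrev residualSpace (τ : q.IsometryEquiv q) : Submodule F V :=
  LinearMap.range (subId τ)

theorem polar_isometry (τ : q.IsometryEquiv q) (x y : V) :
    QuadraticMap.polar q (τ x) (τ y) = QuadraticMap.polar q x y := by
  have h : τ x + τ y = τ (x + y) := (τ.toLinearEquiv.map_add x y).symm
  simp only [QuadraticMap.polar, h, QuadraticMap.IsometryEquiv.map_app]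

/-- The map sending `y` to the linear form `u ↦ b_q(u, y)` on the residual space. -/
def polarOnResidual (τ : q.IsometryEquiv q) : V →ₗ[F] residualSpace τ →ₗ[F] F :=
  (q.polarBilin.flip).compl₂ (residualSpace τ).subtype

theorem ker_subId_le (τ : q.IsometryEquiv q) :
    LinearMap.ker (subId τ) ≤ LinearMap.ker (polarOnResidual τ) := by
  intro z hz
  have hz' : τ z = z := by simpa [sub_eq_zero] using hz
  rw [LinearMap.mem_ker]
  ext ⟨u, x, rfl⟩
  have h := polar_isometry τ x z
  rw [hz'] at h
  simp [polarOnResidual, h]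

/-- The Wall form on the residual space: `ω_τ(τ x - x, τ y - y) = b_q(τ x - x, y)`, see
`wallForm_apply`. -/
def wallForm (τ : q.IsometryEquiv q) : LinearMap.BilinForm F (residualSpace τ) :=
  (((LinearMap.ker (subId τ)).liftQ (polarOnResidual τ) (ker_subId_le τ)).comp
    ((subId τ).quotKerEquivRange.symm : residualSpace τ →ₗ[F] _)).flip

theorem wallForm_apply (τ : q.IsometryEquiv q) (x y : V) :
    wallForm τ ⟨τ x - x, x, rfl⟩ ⟨τ y - y, y, rfl⟩ = QuadraticMap.polar q (τ x - x) y := by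
  have h : (subId τ).quotKerEquivRange.symm ⟨τ y - y, y, rfl⟩ =
      (LinearMap.ker (subId τ)).mkQ y :=
    (subId τ).quotKerEquivRange_symm_apply_image y ⟨y, rfl⟩
  unfold wallForm
  rw [LinearMap.flip_apply, LinearMap.comp_apply]
  erw [h]
  rfl

end Isometries

section BilinearForms

variable {M : Type*} [AddCommGroup M] [Module F M]

/-- The bilinear form `B ⊥ ⋯ ⊥ B` (`r` times). -/
def copies (r : ℕ) (B : LinearMap.BilinForm F M) : LinearMap.BilinForm F (Fin r → M) :=
  ∑ i : Fin r, B.compl₁₂ (LinearMap.proj i) (LinearMap.proj i)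

theorem copies_apply (r : ℕ) (B : LinearMap.BilinForm F M) (x y : Fin r → M) :
    copies r B x y = ∑ i, B (x i) (y i) := by
  simp [copies, LinearMap.sum_apply]

/-- The one-dimensional form `⟨α⟩`: `(x, y) ↦ α x y`. -/
def rankOne (α : F) : LinearMap.BilinForm F F :=
  α • LinearMap.mul F F

theorem rankOne_apply (α x y : F) : rankOne α x y = α * (x * y) := rfl

/-- The hyperbolic plane `ℍ_λ`, with basis `u, v` such that `b(u,u) = b(v,v) = 0`, `b(u,v) = 1`
and `b(v,u) = λ` (for `λ = ±1` this says `b(u,v) = λ b(v,u) = 1`). -/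
def hyperbolicPlane (l : F) : LinearMap.BilinForm F (F × F) :=
  (LinearMap.mul F F).compl₁₂ (LinearMap.fst F F F) (LinearMap.snd F F F) +
    l • (LinearMap.mul F F).compl₁₂ (LinearMap.snd F F F) (LinearMap.fst F F F)

theorem hyperbolicPlane_apply (l : F) (x y : F × F) :
    hyperbolicPlane l x y = x.1 * y.2 + l * (x.2 * y.1) := rfl

end BilinearForms

section Involutions

/-- An `F`-linear involution (of the first kind) on an `F`-algebra: an `F`-linear
anti-automorphism whose square is the identity. -/
structure AlgInvolution (F A : Type*) [Field F] [Ring A] [Algebra F A] where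
  /-- the underlying linear map -/
  toFun : A →ₗ[F] A
  anti_mul : ∀ a b : A, toFun (a * b) = toFun b * toFun a
  involutive : ∀ a : A, toFun (toFun a) = a

variable {A B : Type*} [Ring A] [Algebra F A] [Ring B] [Algebra F B]

/-- `(A, σ) ≃ (B, ρ)` as `F`-algebras with involution. -/
def AlgInvolution.Isomorphic (σ : AlgInvolution F A) (ρ : AlgInvolution F B) : Prop :=
  ∃ f : A ≃ₐ[F] B, ∀ a : A, f (σ.toFun a) = ρ.toFun (f a)

/-- The transpose involution on `M_m(F)`. -/
def transposeInvolution (F : Type*) [Field F] (m : ℕ) :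
    AlgInvolution F (Matrix (Fin m) (Fin m) F) where
  toFun := (Matrix.transposeLinearEquiv (Fin m) (Fin m) F F : _ →ₗ[F] _)
  anti_mul a b := Matrix.transpose_mul a b
  involutive a := Matrix.transpose_transpose a

variable {V : Type*} [AddCommGroup V] [Module F V] {q : QuadraticForm F V}

theorem reverse_map (τ : q.IsometryEquiv q) (a : CliffordAlgebra q) :
    CliffordAlgebra.reverse (CliffordAlgebra.map τ.toIsometry a) =
      CliffordAlgebra.map τ.toIsometry (CliffordAlgebra.reverse a) := by
  induction a using CliffordAlgebra.induction with
  | algebraMap r => simp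
  | ι x => simp
  | mul a b ha hb => simp [ha, hb]
  | add a b ha hb => simp [ha, hb]

/-- The involution `J_τ` of the Clifford algebra `C(q)` induced by an isometry `τ` with
`τ² = id`. It is the unique involution with `J_τ(v) = τ(v)` for `v ∈ V`, see
`cliffordInvolution_ι`. -/
def cliffordInvolution (τ : q.IsometryEquiv q) (hτ : ∀ x, τ (τ x) = x) :
    AlgInvolution F (CliffordAlgebra q) where
  toFun := CliffordAlgebra.reverse ∘ₗ (CliffordAlgebra.map τ.toIsometry).toLinearMap
  anti_mul a b := by simp
  involutive a := by
    have h : τ.toIsometry.comp τ.toIsometry = QuadraticMap.Isometry.id q := by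
      ext x
      exact hτ x
    simp only [LinearMap.comp_apply, AlgHom.toLinearMap_apply, reverse_map,
      CliffordAlgebra.reverse_reverse]
    rw [← AlgHom.comp_apply, CliffordAlgebra.map_comp_map, h, CliffordAlgebra.map_id]
    rfl

theorem cliffordInvolution_ι (τ : q.IsometryEquiv q) (hτ : ∀ x, τ (τ x) = x) (v : V) :
    (cliffordInvolution τ hτ).toFun (CliffordAlgebra.ι q v) = CliffordAlgebra.ι q (τ v) := by
  simp [cliffordInvolution]

end Involutions

end WallForm

end

/-! In characteristic 2, expanding `q (τ x) = q ((τ x - x) + x)` gives `ω_τ(u,u) = q(u)` on the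
residual space, so conditions 2 and 3 agree. A fixed vector becomes a symmetric matrix `M` with `M²
= q(x)`; a diagonal entry of `M²` is a sum of squares, hence a square, and 1 implies 2.

If every `ω_τ(x,x)` is a square, its square root `l` is a linear form, because the Frobenius map is
additive and injective. When `l = 0` the form is alternating and has a symplectic basis; otherwise
it has an orthonormal basis (`exists_orthonormal`). This is 3 implies 4.

For 4 implies 1, `exists_decomposition` splits `V` into the residual space and a complement on which
`q` has the form `w ↦ ω_τ(h w, h w)`, with `τ` acting as `(p, d) ↦ (p + d, d)`. A normal basis of
`ω_τ` cuts `(V, q, τ)` into blocks of dimension 2 or 4, each with an explicit matrix representation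
turning `τ` into the transpose. Kronecker products combine the blocks (`HasTransposeRep.prod`), and
`lift_bijective` shows that the resulting map from `C(q)` is an isomorphism. -/

namespace WallForm

open Module

/-! ### Spans of ordered monomials. -/

section MonomialSpan

variable {F A ι : Type*} [Field F] [Ring A] [Algebra F A]

/-- The span of the products `f i₁ * ⋯ * f iₖ` where `[i₁, …, iₖ]` runs over the sublists of a
given list. -/
def monomialSpan (f : ι → A) : List ι → Submodule F A
  | [] => Submodule.span F {1}
  | i :: l => monomialSpan f l ⊔ (monomialSpan f l).map (LinearMap.mulLeft F (f i))

theorem one_mem_monomialSpan (f : ι → A) (l : List ι) :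
    (1 : A) ∈ monomialSpan (F := F) f l := by
  induction l with
  | nil => exact Submodule.mem_span_singleton_self 1
  | cons i l ih => exact Submodule.mem_sup_left ih

instance finiteDimensional_monomialSpan (f : ι → A) (l : List ι) :
    FiniteDimensional F (monomialSpan (F := F) f l) := by
  induction l with
  | nil => exact inferInstanceAs (FiniteDimensional F (Submodule.span F {(1 : A)}))
  | cons i l ih =>
    exact inferInstanceAs (FiniteDimensional F
      (monomialSpan f l ⊔ (monomialSpan f l).map (LinearMap.mulLeft F (f i)) :
        Submodule F A))

theorem finrank_monomialSpan_le (f : ι → A) (l : List ι) :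
    finrank F (monomialSpan (F := F) f l) ≤ 2 ^ l.length := by
  induction l with
  | nil => exact (finrank_span_le_card (R := F) ({1} : Set A)).trans (by simp)
  | cons i l ih =>
    have h1 := Submodule.finrank_add_le_finrank_add_finrank (monomialSpan (F := F) f l)
      ((monomialSpan f l).map (LinearMap.mulLeft F (f i)))
    have h2 := Submodule.finrank_map_le (LinearMap.mulLeft F (f i)) (monomialSpan (F := F) f l)
    simp only [List.length_cons, pow_succ]
    exact h1.trans (by omega)

/-- The relation `hB` moves `f i` to the right past earlier generators, up to scalar terms, until it
meets its own slot, where `f i * f i` is a scalar. -/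
theorem mul_mem_monomialSpan {f : ι → A} {B : ι → ι → F}
    (hB : ∀ i j, f i * f j + f j * f i = algebraMap F A (B i j))
    {Q : ι → F} (hQ : ∀ i, f i * f i = algebraMap F A (Q i))
    {l : List ι} {i : ι} (hi : i ∈ l) {x : A} (hx : x ∈ monomialSpan (F := F) f l) :
    f i * x ∈ monomialSpan (F := F) f l := by
  induction l generalizing x with
  | nil => simp at hi
  | cons j l ih =>
    obtain ⟨y, hy, _, ⟨z, hz, rfl⟩, rfl⟩ := Submodule.mem_sup.1 hx
    rw [LinearMap.mulLeft_apply, mul_add]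
    by_cases hij : i = j
    · subst hij
      refine add_mem (Submodule.mem_sup_right ⟨y, hy, rfl⟩) (Submodule.mem_sup_left ?_)
      rw [← mul_assoc, hQ, ← Algebra.smul_def]
      exact Submodule.smul_mem _ _ hz
    · have hi' : i ∈ l := (List.mem_cons.1 hi).resolve_left hij
      refine add_mem (Submodule.mem_sup_left (ih hi' hy)) ?_
      have h : f i * (f j * z) = B i j • z - f j * (f i * z) := by
        rw [Algebra.smul_def, ← hB]; noncomm_ring
      rw [h]
      exact sub_mem (Submodule.mem_sup_left (Submodule.smul_mem _ _ hz))
        (Submodule.mem_sup_right ⟨_, ih hi' hz, rfl⟩)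

theorem mul_eq_mul_of_mem_monomialSpan {f : ι → A} {u : A} {l : List ι}
    (h : ∀ i ∈ l, u * f i = f i * u) {x : A} (hx : x ∈ monomialSpan (F := F) f l) :
    u * x = x * u := by
  induction l generalizing x with
  | nil =>
    obtain ⟨a, rfl⟩ := Submodule.mem_span_singleton.1 hx
    simp
  | cons j l ih =>
    obtain ⟨y, hy, _, ⟨z, hz, rfl⟩, rfl⟩ := Submodule.mem_sup.1 hx
    have hl := fun {x} => ih (x := x) fun i hi => h i (List.mem_cons_of_mem _ hi)
    rw [LinearMap.mulLeft_apply, mul_add, add_mul, hl hy, ← mul_assoc, h j (by simp),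
      mul_assoc, hl hz, mul_assoc]

/-- If every `f i` has a partner `u i` commuting with the other `f j` and satisfying
`u i * f i - f i * u i = 1`, then the monomials in the `f i` are linearly independent. -/
theorem finrank_monomialSpan [Nontrivial A] {f u : ι → A}
    (h : ∀ i j, i ≠ j → u i * f j = f j * u i) (h1 : ∀ i, u i * f i = f i * u i + 1)
    {l : List ι} (hl : l.Nodup) :
    finrank F (monomialSpan (F := F) f l) = 2 ^ l.length := by
  induction l with
  | nil => exact (finrank_span_singleton (K := F) (one_ne_zero (α := A))).trans (by simp)
  | cons i l ih =>
    obtain ⟨hil, hl⟩ := List.nodup_cons.1 hl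
    have hc : ∀ x ∈ monomialSpan (F := F) f l, u i * x = x * u i := fun x hx =>
      mul_eq_mul_of_mem_monomialSpan (fun j hj => h i j (by rintro rfl; exact hil hj)) hx
    -- The commutator with `u i` acts as differentiation by `f i`: it kills the span of the
    -- remaining monomials but sends `f i * x` to `x`.
    have key : ∀ x ∈ monomialSpan (F := F) f l,
        f i * x ∈ monomialSpan (F := F) f l → x = 0 := by
      intro x hx hfx
      have := hc _ hfx
      rw [← mul_assoc, h1, add_mul, mul_assoc, hc x hx, one_mul, ← mul_assoc] at this
      simpa using this
    have hinj : finrank F ((monomialSpan (F := F) f l).map (LinearMap.mulLeft F (f i))) =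
        finrank F (monomialSpan (F := F) f l) := by
      rw [← LinearMap.range_domRestrict]
      refine LinearMap.finrank_range_of_inj ?_
      rw [← LinearMap.ker_eq_bot, LinearMap.ker_eq_bot']
      rintro ⟨x, hx⟩ h0
      have h0 : f i * x = 0 := h0
      exact Subtype.ext (key x hx (h0 ▸ zero_mem _))
    have hdisj : monomialSpan (F := F) f l ⊓
        (monomialSpan f l).map (LinearMap.mulLeft F (f i)) = ⊥ := by
      rw [eq_bot_iff]
      rintro _ ⟨hy, x, hx, rfl⟩
      simp [key x hx hy]
    have := Submodule.finrank_sup_add_finrank_inf_eq (monomialSpan (F := F) f l)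
      ((monomialSpan f l).map (LinearMap.mulLeft F (f i)))
    rw [hdisj, finrank_bot, hinj, ih hl] at this
    rw [List.length_cons, pow_succ, mul_two]
    exact this

end MonomialSpan

/-! ### Dimension of the Clifford algebra and isomorphism from a dimension count. -/

section Clifford

variable {F V A : Type*} [Field F] [AddCommGroup V] [Module F V] {q : QuadraticForm F V}
  [Ring A] [Algebra F A]

theorem mul_add_mul_eq_polar {f : V →ₗ[F] A} (hf : ∀ v, f v * f v = algebraMap F A (q v))
    (u v : V) : f u * f v + f v * f u = algebraMap F A (QuadraticMap.polar q u v) := by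
  rw [QuadraticMap.polar, map_sub, map_sub, ← hf, ← hf, ← hf, map_add]
  noncomm_ring

theorem mem_of_one_mem_of_ι_mul_mem (T : Submodule F (CliffordAlgebra q)) (h1 : 1 ∈ T)
    (hmul : ∀ v, ∀ x ∈ T, CliffordAlgebra.ι q v * x ∈ T) (x : CliffordAlgebra q) : x ∈ T := by
  suffices ∀ y ∈ T, x * y ∈ T by simpa using this 1 h1
  induction x using CliffordAlgebra.induction with
  | algebraMap r => exact fun y hy => Algebra.smul_def r y ▸ T.smul_mem r hy
  | ι v => exact hmul v
  | mul a b ha hb => exact fun y hy => by rw [mul_assoc]; exact ha _ (hb _ hy)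
  | add a b ha hb => exact fun y hy => by rw [add_mul]; exact add_mem (ha _ hy) (hb _ hy)

theorem monomialSpan_ι_eq_top {N : ℕ} (b : Basis (Fin N) F V) :
    monomialSpan (F := F) (fun i => CliffordAlgebra.ι q (b i)) (List.finRange N) = ⊤ := by
  refine eq_top_iff.2 fun x _ => mem_of_one_mem_of_ι_mul_mem _ (one_mem_monomialSpan _ _) ?_ x
  intro v x hx
  rw [← b.sum_repr v, map_sum, Finset.sum_mul]
  refine Submodule.sum_mem _ fun i _ => ?_
  rw [map_smul, smul_mul_assoc]
  refine Submodule.smul_mem _ _ (mul_mem_monomialSpan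
    (B := fun i j => QuadraticMap.polar q (b i) (b j)) (Q := fun i => q (b i)) ?_ ?_
    (List.mem_finRange i) hx)
  · exact fun i j => CliffordAlgebra.ι_mul_ι_add_swap _ _
  · exact fun i => CliffordAlgebra.ι_sq_scalar q _

theorem finiteDimensional_cliffordAlgebra [FiniteDimensional F V] :
    FiniteDimensional F (CliffordAlgebra q) := by
  have h := monomialSpan_ι_eq_top (q := q) (finBasis F V)
  exact Module.finite_def.2 (h ▸ (Module.Finite.iff_fg.1 inferInstance))

theorem finrank_cliffordAlgebra_le [FiniteDimensional F V] :
    finrank F (CliffordAlgebra q) ≤ 2 ^ finrank F V := by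
  rw [← finrank_top, ← monomialSpan_ι_eq_top (q := q) (finBasis F V)]
  simpa using finrank_monomialSpan_le (F := F)
    (fun i => CliffordAlgebra.ι q (finBasis F V i)) (List.finRange _)

theorem IsQuadraticSpace.nondegenerate (hq : IsQuadraticSpace q) :
    LinearMap.BilinForm.Nondegenerate (QuadraticMap.polarBilin q) :=
  ⟨hq, fun x hx => hq x fun y => by
    rw [QuadraticMap.polar_comm]; exact hx y⟩

theorem map_monomialSpan {B ι : Type*} [Ring B] [Algebra F B] (g : A →ₐ[F] B) (f : ι → A)
    (l : List ι) : (monomialSpan (F := F) f l).map g.toLinearMap =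
      monomialSpan (F := F) (fun i => g (f i)) l := by
  induction l with
  | nil => simp [monomialSpan, Submodule.map_span]
  | cons i l ih =>
    simp only [monomialSpan, Submodule.map_sup, ih]
    congr 1
    rw [← ih, ← Submodule.map_comp, ← Submodule.map_comp]
    congr 1
    ext x
    simp

/-- In characteristic two, a Clifford map from a nondegenerate quadratic space into an algebra of
dimension `2 ^ dim V` induces an isomorphism. -/
theorem lift_bijective [CharP F 2] [FiniteDimensional F V] (hq : IsQuadraticSpace q)
    (f : V →ₗ[F] A) (hf : ∀ v, f v * f v = algebraMap F A (q v))
    (hA : finrank F A = 2 ^ finrank F V) :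
    Function.Bijective (CliffordAlgebra.lift q ⟨f, hf⟩) := by
  have hpos : 0 < finrank F A := by rw [hA]; positivity
  have := finite_of_finrank_pos hpos
  have := nontrivial_of_finrank_pos hpos
  have := finiteDimensional_cliffordAlgebra (q := q)
  have hA2 : ∀ a : A, a + a = 0 := fun a => by
    rw [← two_smul F a, CharTwo.two_eq_zero, zero_smul]
  set b := finBasis F V
  have hB := hq.nondegenerate
  set d := LinearMap.BilinForm.dualBasis _ hB b
  have hd : ∀ i j, QuadraticMap.polar q (d i) (b j) = if j = i then 1 else 0 := fun i j =>
    LinearMap.BilinForm.apply_dualBasis_left hB b i j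
  have hrank : finrank F (monomialSpan (F := F) (fun i => f (b i)) (List.finRange _)) =
      2 ^ finrank F V := by
    -- The images of the polar-dual basis serve as partners: in characteristic 2 the
    -- anticommutators, equal to `0` or `1`, are also commutators.
    rw [finrank_monomialSpan (u := fun i => f (d i)) ?_ ?_ (List.nodup_finRange _),
      List.length_finRange]
    · intro i j hij
      have := mul_add_mul_eq_polar hf (d i) (b j)
      rw [hd, if_neg (Ne.symm hij), map_zero] at this
      rw [← sub_eq_zero, ← this, ← sub_eq_zero, ← hA2 (- (f (b j) * f (d i)))]
      abel
    · intro i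
      have := mul_add_mul_eq_polar hf (d i) (b i)
      rw [hd, if_pos rfl, map_one] at this
      rw [← this, add_comm, add_assoc, hA2, add_zero]
  have hsurj : Function.Surjective (CliffordAlgebra.lift q ⟨f, hf⟩) := by
    have h1 := Submodule.eq_top_of_finrank_eq (hrank.trans hA.symm)
    have h2 := map_monomialSpan (CliffordAlgebra.lift q ⟨f, hf⟩)
      (fun i => CliffordAlgebra.ι q (b i)) (List.finRange (finrank F V))
    simp only [CliffordAlgebra.lift_ι_apply] at h2
    intro y
    have hy : y ∈ (⊤ : Submodule F A) := trivial
    rw [← h1, ← h2] at hy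
    obtain ⟨x, -, hx⟩ := hy
    exact ⟨x, hx⟩
  have hfin : finrank F (CliffordAlgebra q) = finrank F A :=
    le_antisymm (hA ▸ finrank_cliffordAlgebra_le)
      (LinearMap.finrank_le_finrank_of_surjective
        (f := (CliffordAlgebra.lift q ⟨f, hf⟩).toLinearMap) hsurj)
  exact ⟨(LinearMap.injective_iff_surjective_of_finrank_eq_finrank
    (f := (CliffordAlgebra.lift q ⟨f, hf⟩).toLinearMap) hfin).2 hsurj, hsurj⟩

end Clifford
end WallForm

namespace WallForm

open Matrix
open scoped Kronecker

/-! ### Matrix Clifford maps carrying a given map to the transpose. -/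

section TransposeRep

variable {F : Type*} [Field F]

/-- A Clifford map `f` for the function `g` into a matrix algebra, which turns `t` into the
transpose. -/
def HasTransposeRep {P : Type*} [AddCommGroup P] [Module F P] (g : P → F) (t : P → P)
    (m : Type*) [Fintype m] [DecidableEq m] : Prop :=
  ∃ f : P →ₗ[F] Matrix m m F,
    (∀ p, f p * f p = algebraMap F (Matrix m m F) (g p)) ∧ ∀ p, f (t p) = (f p)ᵀ

variable {P P' : Type*} [AddCommGroup P] [Module F P] [AddCommGroup P'] [Module F P']
  {m m' : Type*} [Fintype m] [DecidableEq m] [Fintype m'] [DecidableEq m']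

theorem HasTransposeRep.reindex {g : P → F} {t : P → P} (h : HasTransposeRep g t m)
    (e : m ≃ m') : HasTransposeRep g t m' := by
  obtain ⟨f, h1, h2⟩ := h
  refine ⟨(reindexAlgEquiv F F e).toLinearMap ∘ₗ f, fun p => ?_, fun p => ?_⟩
  · simp only [LinearMap.comp_apply, AlgEquiv.toLinearMap_apply]
    rw [← map_mul, h1, AlgEquiv.commutes]
  · simp [h2]

theorem HasTransposeRep.comp {g : P → F} {t : P → P} (h : HasTransposeRep g t m)
    (φ : P' →ₗ[F] P) {g' : P' → F} {t' : P' → P'} (hg : ∀ p, g' p = g (φ p))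
    (ht : ∀ p, φ (t' p) = t (φ p)) : HasTransposeRep g' t' m := by
  obtain ⟨f, h1, h2⟩ := h
  exact ⟨f ∘ₗ φ, fun p => by simp [h1, hg], fun p => by simp [h2, ht]⟩

/-- The map is `f ⊗ 1 + 1 ⊗ f'`. Its cross terms are twice `f ⊗ f'`, so they vanish in
characteristic 2 and no graded tensor product is needed. -/
theorem HasTransposeRep.prod [CharP F 2] {g : P → F} {t : P → P} {g' : P' → F} {t' : P' → P'}
    (h : HasTransposeRep g t m) (h' : HasTransposeRep g' t' m') :
    HasTransposeRep (fun p : P × P' => g p.1 + g' p.2) (fun p => (t p.1, t' p.2)) (m × m') := by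
  obtain ⟨f, h1, h2⟩ := h
  obtain ⟨f', h1', h2'⟩ := h'
  refine ⟨(kroneckerBilinear (R := F) (α := F) (l := m) (m := m)).flip (1 : Matrix m' m' F) ∘ₗ f ∘ₗ LinearMap.fst F P P' +
    kroneckerBilinear (R := F) (α := F) (1 : Matrix m m F) ∘ₗ f' ∘ₗ LinearMap.snd F P P', fun p => ?_, fun p => ?_⟩
  · have h0 : ∀ M : Matrix (m × m') (m × m') F, M + M = 0 := fun M => by
      rw [← two_smul F M, CharTwo.two_eq_zero, zero_smul]
    simp only [LinearMap.add_apply, LinearMap.comp_apply, LinearMap.flip_apply,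
      LinearMap.fst_apply, LinearMap.snd_apply]
    change (f p.1 ⊗ₖ 1 + 1 ⊗ₖ f' p.2) * (f p.1 ⊗ₖ 1 + 1 ⊗ₖ f' p.2) = _
    simp only [mul_add, add_mul, ← mul_kronecker_mul, one_mul, mul_one, h1, h1',
      Algebra.algebraMap_eq_smul_one, smul_kronecker, kronecker_smul, one_kronecker_one]
    rw [add_smul, ← sub_eq_zero, ← h0 (f p.1 ⊗ₖ f' p.2)]
    abel
  · simp only [LinearMap.add_apply, LinearMap.comp_apply, LinearMap.flip_apply,
      LinearMap.fst_apply, LinearMap.snd_apply, h2, h2', transpose_add]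
    change (f p.1)ᵀ ⊗ₖ 1 + 1 ⊗ₖ (f' p.2)ᵀ = (f p.1 ⊗ₖ 1)ᵀ + (1 ⊗ₖ f' p.2)ᵀ
    rw [← kroneckerMap_transpose, ← kroneckerMap_transpose, transpose_one, transpose_one]

theorem HasTransposeRep.pi [CharP F 2] {k : ℕ} {t : P → P} (r : ℕ) {g : Fin r → P → F}
    (h : ∀ i, HasTransposeRep (g i) t (Fin k)) :
    HasTransposeRep (fun p : Fin r → P => ∑ i, g i (p i)) (fun p i => t (p i))
      (Fin (k ^ r)) := by
  induction r with
  | zero => exact ⟨0, fun p => by simp only [Finset.univ_eq_empty, Finset.sum_empty, map_zero,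
      LinearMap.zero_apply, mul_zero], fun p => by
        simp only [LinearMap.zero_apply, transpose_zero]⟩
  | succ r ih =>
    refine (((h 0).prod (ih fun i => h i.succ)).comp
      ((LinearMap.proj 0).prod (LinearMap.pi fun i => LinearMap.proj i.succ)) ?_ ?_).reindex
      (finProdFinEquiv.trans (finCongr (by rw [pow_succ, mul_comm])))
    · intro p
      simp [Fin.sum_univ_succ]
    · intro p
      rfl

/-- The block for one vector of an orthonormal basis. Replacing `x` by `x + y` swaps the two
off-diagonal entries `x + c y` and `x + (c + 1) y`. -/
theorem hasTransposeRep_two [CharP F 2] (c : F) :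
    HasTransposeRep (fun p : F × F => p.1 ^ 2 + c * p.2 ^ 2 + p.1 * p.2)
      (fun p => (p.1 + p.2, p.2)) (Fin 2) := by
  have h2 : (2 : F) = 0 := CharTwo.two_eq_zero
  refine ⟨
    { toFun := fun p => !![c * p.2, p.1 + c * p.2; p.1 + (c + 1) * p.2, c * p.2]
      map_add' := fun p p' => by
        ext i j; fin_cases i <;> fin_cases j <;> simp <;> ring
      map_smul' := fun a p => by
        ext i j; fin_cases i <;> fin_cases j <;> simp <;> ring }, fun p => ?_, fun p => ?_⟩
  · ext i j
    fin_cases i <;> fin_cases j <;> simp [Matrix.algebraMap_matrix_apply] <;> grind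
  · ext i j
    fin_cases i <;> fin_cases j <;> simp <;> grind

/-- The block for one hyperbolic plane of the Wall form. With `J` the all-ones 2×2 matrix (so `J² =
0`) and `σ` the swap, the first two matrices are `σ ⊗ J` and `J ⊗ σ`; the third and fourth differ
from their transposes by the first and second respectively. -/
theorem hasTransposeRep_four [CharP F 2] :
    HasTransposeRep (fun p : (F × F) × (F × F) => p.1.1 * p.2.2 + p.1.2 * p.2.1)
      (fun p => (p.1 + p.2, p.2)) (Fin 4) := by
  have h2 : (2 : F) = 0 := CharTwo.two_eq_zero
  refine ⟨
    { toFun := fun p =>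
        p.1.1 • !![0, 0, 1, 1; 0, 0, 1, 1; 1, 1, 0, 0; 1, 1, 0, 0] +
        p.1.2 • !![0, 1, 0, 1; 1, 0, 1, 0; 0, 1, 0, 1; 1, 0, 1, 0] +
        p.2.1 • !![0, 0, 0, 0; 0, 0, 1, 1; 1, 0, 1, 1; 1, 0, 1, 1] +
        p.2.2 • !![0, 0, 0, 0; 1, 1, 0, 1; 0, 1, 0, 1; 1, 1, 0, 1]
      map_add' := fun p p' => by
        simp only [Prod.fst_add, Prod.snd_add, add_smul]; abel
      map_smul' := fun a p => by
        simp only [Prod.smul_fst, Prod.smul_snd, smul_add, mul_smul, smul_eq_mul,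
          RingHom.id_apply] }, fun p => ?_, fun p => ?_⟩
  · obtain ⟨⟨a, b⟩, c, d⟩ := p
    ext i j
    fin_cases i <;> fin_cases j <;>
      simp [Matrix.algebraMap_matrix_apply, Matrix.mul_apply, Fin.sum_univ_four] <;> grind
  · obtain ⟨⟨a, b⟩, c, d⟩ := p
    ext i j
    fin_cases i <;> fin_cases j <;> simp <;> grind

end TransposeRep
end WallForm

namespace WallForm

open Module

/-! ### Symmetric bilinear forms with square values on the diagonal. -/

section Classification

universe u v

variable {F : Type u} [Field F]

/-- A form-preserving linear map out of a nondegenerate space is an equivalence when the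
dimensions agree. -/
theorem equivalent_of_map_eq {M W : Type*} [AddCommGroup M] [Module F M] [AddCommGroup W]
    [Module F W] [FiniteDimensional F M] [FiniteDimensional F W] {B : LinearMap.BilinForm F M}
    {ω : LinearMap.BilinForm F W} (hB : ∀ x, (∀ y, B x y = 0) → x = 0) (φ : M →ₗ[F] W)
    (hφ : ∀ x y, ω (φ x) (φ y) = B x y) (hd : finrank F M = finrank F W) :
    ω.Equivalent B := by
  have hinj : Function.Injective φ := by
    rw [← LinearMap.ker_eq_bot, LinearMap.ker_eq_bot']
    exact fun x hx => hB x fun y => by rw [← hφ, hx, map_zero, LinearMap.zero_apply]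
  have e : B.IsometryEquiv ω :=
    { LinearEquiv.ofInjectiveOfFinrankEq φ hinj hd with
      map_app' := hφ }
  exact ⟨e.symm⟩

theorem copies_rankOne_separatingLeft (r : ℕ) (x : Fin r → F)
    (hx : ∀ y, copies r (rankOne (1 : F)) x y = 0) : x = 0 := by
  ext i
  simpa [copies_apply, rankOne_apply, Pi.single_apply] using hx (Pi.single i 1)

theorem copies_hyperbolicPlane_separatingLeft (r : ℕ) {l : F} (hl : l ≠ 0)
    (x : Fin r → F × F) (hx : ∀ y, copies r (hyperbolicPlane l) x y = 0) : x = 0 := by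
  ext i
  · simpa [copies_apply, hyperbolicPlane_apply, Pi.single_apply, apply_ite Prod.fst,
      apply_ite Prod.snd] using hx (Pi.single i (0, 1))
  · simpa [copies_apply, hyperbolicPlane_apply, Pi.single_apply, apply_ite Prod.fst,
      apply_ite Prod.snd, hl] using hx (Pi.single i (1, 0))

variable {W : Type v} [AddCommGroup W] [Module F W]

theorem finrank_ker_of_surjective [FiniteDimensional F W] {U : Type*} [AddCommGroup U]
    [Module F U] (L : W →ₗ[F] U) (hL : Function.Surjective L) :
    finrank F (LinearMap.ker L) + finrank F U = finrank F W := by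
  rw [← L.finrank_range_add_finrank_ker, LinearMap.range_eq_top.2 hL, finrank_top, add_comm]

/-- In characteristic two, if `ω x x` is always a square, it is the square of a linear form. -/
theorem exists_linear_sq [CharP F 2] {ω : LinearMap.BilinForm F W}
    (hs : ∀ x y, ω x y = ω y x) (hsq : ∀ x, IsSquare (ω x x)) :
    ∃ l : W →ₗ[F] F, ∀ x, ω x x = l x ^ 2 := by
  choose l hl using hsq
  -- Square roots are unique in characteristic 2, so the chosen root is forced to be additive and
  -- homogeneous.
  have hinj : ∀ a b : F, a * a = b * b → a = b := fun a b h =>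
    frobenius_inj F 2 (by simpa [frobenius_def, sq] using h)
  refine ⟨{ toFun := l, map_add' := fun x y => hinj _ _ ?_, map_smul' := fun a x => hinj _ _ ?_ },
    fun x => by rw [hl, sq]; rfl⟩
  · rw [CharTwo.add_mul_self, ← hl, ← hl, ← hl]
    simp only [map_add, LinearMap.add_apply]
    rw [hs y x, add_assoc, ← add_assoc (ω x y), CharTwo.add_self_eq_zero, zero_add]
  · rw [← hl]
    simp only [map_smul, LinearMap.smul_apply, smul_eq_mul, RingHom.id_apply]
    rw [hl]
    ring

/-- A nondegenerate symmetric form with `ω x x = l x ^ 2`, where `l ≠ 0` unless the space is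
trivial, has an orthonormal basis. -/
theorem exists_orthonormal [FiniteDimensional F W] {ω : LinearMap.BilinForm F W}
    (hs : ∀ x y, ω x y = ω y x) (hnd : ∀ x, (∀ y, ω x y = 0) → x = 0) (l : W →ₗ[F] F)
    (hl : ∀ x, ω x x = l x ^ 2) {n : ℕ} (hn : finrank F W = n) (h0 : l = 0 → n = 0) :
    ∃ e : Fin n → W, ∀ i j, ω (e i) (e j) = if i = j then 1 else 0 := by
  induction n generalizing W with
  | zero => exact ⟨Fin.elim0, fun i => i.elim0⟩
  | succ n ih =>
    obtain ⟨x₀, hx₀⟩ : ∃ x, l x ≠ 0 := by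
      by_contra! h
      exact absurd (h0 (LinearMap.ext h)) (Nat.succ_ne_zero n)
    have hndg : ω.Nondegenerate := ⟨hnd, fun x hx => hnd x fun y => by rw [hs]; exact hx y⟩
    obtain ⟨z, hz⟩ := (LinearMap.BilinForm.toDual ω hndg).surjective l
    have hz : ∀ y, ω z y = l y := fun y => by
      rw [← LinearMap.BilinForm.toDual_def hndg, hz]
    have hlsurj : Function.Surjective l := LinearMap.surjective_of_ne_zero fun h => hx₀ (by simp [h])
    -- The induction fails only if `l` vanishes on a nonzero `e^⊥`. Since `l e = 1`, vanishing there
    -- means `l = ω e`, that is, `e = z`. If `e = z` in positive remaining dimension, adding a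
    -- nonzero vector of `ker l` avoids this.
    obtain ⟨e, he, hez⟩ : ∃ e, l e = 1 ∧ (e = z → n = 0) := by
      obtain ⟨e, he⟩ := hlsurj 1
      by_cases hez : e = z
      · by_cases hn0 : n = 0
        · exact ⟨e, he, fun _ => hn0⟩
        · have hk := finrank_ker_of_surjective l hlsurj
          rw [hn, finrank_self] at hk
          have : LinearMap.ker l ≠ ⊥ := fun h => hn0 (by rw [h, finrank_bot] at hk; omega)
          obtain ⟨w, hw, hw0⟩ := Submodule.exists_mem_ne_zero_of_ne_bot this
          refine ⟨e + w, by rw [map_add, he, LinearMap.mem_ker.1 hw, add_zero], fun h => ?_⟩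
          rw [hez] at h
          exact absurd (by simpa using h) hw0
      · exact ⟨e, he, fun h => absurd h hez⟩
    have hee : ω e e = 1 := by rw [hl, he, one_pow]
    have hesurj : Function.Surjective (ω e) := LinearMap.surjective_of_ne_zero fun h => by
      rw [h] at hee; exact zero_ne_one hee
    have hproj : ∀ y, y - ω e y • e ∈ LinearMap.ker (ω e) := fun y => by
      simp [LinearMap.mem_ker, hee]
    have hfr := finrank_ker_of_surjective _ hesurj
    rw [finrank_self] at hfr
    obtain ⟨e', he'⟩ := ih (ω := ω.restrict (LinearMap.ker (ω e)))
      (fun x y => hs x y) (fun x hx => Subtype.ext (hnd x fun y => by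
        have h1 : ω x (y - ω e y • e) = 0 := hx ⟨_, hproj y⟩
        have h2 : ω x e = 0 := by rw [hs]; exact x.2
        simpa [h2] using h1)) (l ∘ₗ (LinearMap.ker (ω e)).subtype) (fun x => hl x) (by omega)
      (fun h => hez (sub_eq_zero.1 (hnd _ fun y => by
        have h1 : l (y - ω e y • e) = 0 := LinearMap.congr_fun h ⟨_, hproj y⟩
        rw [map_sub, map_smul, he, smul_eq_mul, mul_one, sub_eq_zero] at h1
        rw [map_sub, LinearMap.sub_apply, hz, h1, sub_self])))
    refine ⟨Fin.cons e fun i => e' i, fun i j => ?_⟩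
    refine Fin.cases ?_ (fun i => ?_) i <;> refine Fin.cases ?_ (fun j => ?_) j
    · simp [hee]
    · simp [(Fin.succ_ne_zero j).symm]
    · simp [Fin.succ_ne_zero i, hs _ e]
    · simpa using he' i j

/-- A nondegenerate alternating form has a symplectic basis. -/
theorem exists_symplectic [FiniteDimensional F W] {ω : LinearMap.BilinForm F W}
    (ha : ω.IsAlt) (hnd : ∀ x, (∀ y, ω x y = 0) → x = 0) :
    ∃ m : ℕ, finrank F W = 2 * m ∧ ∃ e f : Fin m → W, (∀ i j, ω (e i) (e j) = 0) ∧
      (∀ i j, ω (f i) (f j) = 0) ∧ ∀ i j, ω (e i) (f j) = if i = j then 1 else 0 := by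
  induction hn : finrank F W using Nat.strong_induction_on generalizing W with
  | _ n ih =>
    subst hn
    by_cases hW : finrank F W = 0
    · exact ⟨0, hW, Fin.elim0, Fin.elim0, fun i => i.elim0, fun i => i.elim0, fun i => i.elim0⟩
    have hneg : ∀ x y, ω x y = -ω y x := fun x y => (ha.neg_eq y x).symm
    have : Nontrivial W := nontrivial_of_finrank_pos (R := F) (Nat.pos_of_ne_zero hW)
    obtain ⟨e, he⟩ := exists_ne (0 : W)
    obtain ⟨f, hf⟩ : ∃ f, ω e f = 1 := by
      obtain ⟨y, hy⟩ : ∃ y, ω e y ≠ 0 := by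
        by_contra! h
        exact he (hnd e h)
      exact ⟨(ω e y)⁻¹ • y, by simp [hy]⟩
    have hfe : ω f e = -1 := by rw [hneg, hf]
    -- The kernel of `L` is the orthogonal complement of the plane spanned by `e` and `f`.
    set L : W →ₗ[F] F × F := (ω e).prod (ω f)
    have hL : Function.Surjective L := fun p =>
      ⟨p.1 • f - p.2 • e, by
        ext <;> simp [L, hf, hfe, ha.self_eq_zero]⟩
    have hproj : ∀ y, y - ω e y • f + ω f y • e ∈ LinearMap.ker L := fun y => by
      rw [LinearMap.mem_ker]
      ext <;> simp [L, hf, hfe, ha.self_eq_zero]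
    have hker : ∀ x ∈ LinearMap.ker L, ω e x = 0 ∧ ω f x = 0 := fun x hx =>
      ⟨congrArg Prod.fst (LinearMap.mem_ker.1 hx), congrArg Prod.snd (LinearMap.mem_ker.1 hx)⟩
    have hker' : ∀ x ∈ LinearMap.ker L, ω x e = 0 ∧ ω x f = 0 := fun x hx => by
      rw [hneg x e, hneg x f, (hker x hx).1, (hker x hx).2, neg_zero]
      exact ⟨rfl, rfl⟩
    have hfr := finrank_ker_of_surjective _ hL
    rw [finrank_prod, finrank_self] at hfr
    obtain ⟨m, hm, e', f', hee, hff, hef⟩ := ih (finrank F (LinearMap.ker L)) (by omega)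
      (ω := ω.restrict (LinearMap.ker L)) (fun x => ha x)
      (fun x hx => Subtype.ext (hnd x fun y => by
        have h1 : ω x (y - ω e y • f + ω f y • e) = 0 := hx ⟨_, hproj y⟩
        simpa [hker' x x.2] using h1)) rfl
    refine ⟨m + 1, by omega, Fin.cons e fun i => e' i, Fin.cons f fun i => f' i, fun i j => ?_,
      fun i j => ?_, fun i j => ?_⟩ <;>
      refine Fin.cases ?_ (fun i => ?_) i <;> refine Fin.cases ?_ (fun j => ?_) j
    · simp [ha.self_eq_zero]
    · simpa using (hker _ (e' j).2).1
    · simpa using (hker' _ (e' i).2).1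
    · simpa using hee i j
    · simp [ha.self_eq_zero]
    · simpa using (hker _ (f' j).2).2
    · simpa using (hker' _ (f' i).2).2
    · simpa using hff i j
    · simp [hf]
    · simpa [(Fin.succ_ne_zero j).symm] using (hker _ (f' j).2).1
    · simpa [Fin.succ_ne_zero i] using (hker' _ (e' i).2).2
    · simpa using hef i j

theorem equivalent_hyperbolic_or_orthonormal [CharP F 2] [FiniteDimensional F W]
    {ω : LinearMap.BilinForm F W} (hs : ∀ x y, ω x y = ω y x)
    (hnd : ∀ x, (∀ y, ω x y = 0) → x = 0) (hsq : ∀ x, IsSquare (ω x x)) {n : ℕ}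
    (hn : finrank F W = n) :
    (∃ m : ℕ, n = 2 * m ∧ ω.Equivalent (copies m (hyperbolicPlane (-1 : F)))) ∨
      ω.Equivalent (copies n (rankOne (1 : F))) := by
  obtain ⟨l, hl⟩ := exists_linear_sq hs hsq
  by_cases h0 : l = 0
  · left
    obtain ⟨m, hm, e, f, hee, hff, hef⟩ := exists_symplectic (ω := ω)
      (fun x => by rw [hl, h0]; simp) hnd
    refine ⟨m, hn ▸ hm, equivalent_of_map_eq
      (copies_hyperbolicPlane_separatingLeft m (neg_ne_zero.2 one_ne_zero))
      (∑ i, ((LinearMap.fst F F F ∘ₗ LinearMap.proj i).smulRight (e i) +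
        (LinearMap.snd F F F ∘ₗ LinearMap.proj i).smulRight (f i))) (fun x y => ?_) ?_⟩
    · have hfe : ∀ i j, ω (f i) (e j) = if i = j then 1 else 0 := fun i j => by
        rw [hs, hef]; simp only [eq_comm]
      simp [LinearMap.sum_apply, copies_apply, hyperbolicPlane_apply, hee, hff, hef, hfe,
        CharTwo.neg_eq, Finset.sum_add_distrib]
    · rw [hm]
      simp [finrank_pi_fintype, mul_comm]
  · right
    obtain ⟨e, he⟩ := exists_orthonormal hs hnd l hl hn fun h => absurd h h0
    refine equivalent_of_map_eq (copies_rankOne_separatingLeft n)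
      (∑ i, (LinearMap.proj (R := F) (φ := fun _ : Fin n => F) i).smulRight (e i))
      (fun x y => ?_) (by simp [hn])
    simp [LinearMap.sum_apply, copies_apply, rankOne_apply, he, mul_comm]

end Classification
end WallForm

namespace WallForm

open Module

/-! ### The Wall form, the decomposition of the space, and the two directions. -/

section Wall

variable {F V : Type*} [Field F] [AddCommGroup V] [Module F V] {q : QuadraticForm F V}
  {τ : q.IsometryEquiv q}

theorem wallForm_eq_polar (u w : residualSpace τ) {y : V} (hy : τ y - y = w) :
    wallForm τ u w = QuadraticMap.polar q u y := by
  obtain ⟨_, x, rfl⟩ := u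
  obtain ⟨_, hw⟩ := w
  subst hy
  exact wallForm_apply τ x y

theorem wallForm_self [CharP F 2] (u : residualSpace τ) : wallForm τ u u = q u := by
  obtain ⟨_, x, rfl⟩ := u
  have h1 := wallForm_apply τ x x
  have h2 := QuadraticMap.map_add q (τ x - x) x
  rw [sub_add_cancel, QuadraticMap.IsometryEquiv.map_app, ← h1, add_comm _ (q x), add_assoc,
    left_eq_add, CharTwo.add_eq_zero] at h2
  exact h2.symm

/-- Since `τ` is an isometry of square the identity, it is self-adjoint for the polar form. -/
theorem wallForm_symm (hτ : ∀ x, τ (τ x) = x) (u w : residualSpace τ) :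
    wallForm τ u w = wallForm τ w u := by
  obtain ⟨_, x, rfl⟩ := u
  obtain ⟨_, y, rfl⟩ := w
  have h := polar_isometry τ (τ x) y
  rw [hτ] at h
  refine (wallForm_apply τ x y).trans (Eq.trans ?_ (wallForm_apply τ y x).symm)
  rw [QuadraticMap.polar_sub_left, QuadraticMap.polar_sub_left, ← h,
    QuadraticMap.polar_comm q (τ y) x, QuadraticMap.polar_comm q y x]

theorem wallForm_separatingLeft (hq : IsQuadraticSpace q) (u : residualSpace τ)
    (hu : ∀ w, wallForm τ u w = 0) : u = 0 :=
  Subtype.ext (hq u fun y => by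
    rw [← wallForm_eq_polar u ⟨τ y - y, y, rfl⟩ rfl, hu])

theorem finrank_residualSpace [FiniteDimensional F V] {n : ℕ} (hn : finrank F V = 2 * n)
    (hrk : residualSpace τ = fixedSpace τ) : finrank F (residualSpace τ) = n := by
  have hker : LinearMap.ker (subId τ) = residualSpace τ := by
    rw [hrk]
    ext x
    simp [fixedSpace, sub_eq_zero]
  have : finrank F (residualSpace τ) + finrank F (LinearMap.ker (subId τ)) = finrank F V :=
    (subId τ).finrank_range_add_finrank_ker
  rw [hker, hn] at this
  omega

/-- The projections of `V` to the residual space attached to a decomposition of `V` as the sum of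
the residual space and a suitable complement. -/
theorem exists_decomposition [CharP F 2] [FiniteDimensional F V] (hq : IsQuadraticSpace q)
    (hτ : ∀ x, τ (τ x) = x) (hrk : residualSpace τ = fixedSpace τ) :
    ∃ (p d : V →ₗ[F] residualSpace τ) (h : residualSpace τ →ₗ[F] residualSpace τ),
      (∀ v, p (τ v) = p v + d v) ∧ (∀ v, d (τ v) = d v) ∧
      ∀ v, q v = wallForm τ (p v) (p v) + wallForm τ (h (d v)) (h (d v)) +
        wallForm τ (p v) (d v) := by
  have hV : ∀ x : V, x + x = 0 := fun x => by
    rw [← two_smul F x, CharTwo.two_eq_zero, zero_smul]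
  have hmem : ∀ x, x ∈ residualSpace τ ↔ τ x = x := fun x => by rw [hrk]; rfl
  have hfix : ∀ w : residualSpace τ, τ (w : V) = w := fun w => (hmem w).1 w.2
  set d : V →ₗ[F] residualSpace τ := (subId τ).rangeRestrict
  have hd : ∀ v, τ v - v = d v := fun v => rfl
  obtain ⟨s₀, hs₀⟩ := d.exists_rightInverse_of_surjective (LinearMap.range_rangeRestrict _)
  have hs₀ : ∀ w, d (s₀ w) = w := LinearMap.congr_fun hs₀
  -- In characteristic 2 a quadratic form need not come from a symmetric bilinear form, so `γ` is
  -- any bilinear form, possibly asymmetric, with `γ w w = q (s₀ w)`.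
  obtain ⟨γ, hγ⟩ := LinearMap.BilinMap.toQuadraticMap_surjective (q.comp s₀)
  have hγ : ∀ w, γ w w = q (s₀ w) := fun w => QuadraticMap.congr_fun hγ w
  have hnd : (wallForm τ).Nondegenerate :=
    ⟨wallForm_separatingLeft hq, fun x hx => wallForm_separatingLeft hq x fun y => by
      rw [wallForm_symm hτ]; exact hx y⟩
  set h := LinearMap.BilinForm.symmCompOfNondegenerate γ (wallForm τ) hnd
  have hh : ∀ w w', wallForm τ (h w) w' = γ w w' := fun w w' =>
    LinearMap.BilinForm.symmCompOfNondegenerate_left_apply γ hnd w' w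
  -- Correcting the section by `h` adds `q (h w)` and the polar term `ω (h w) w = γ w w`; the latter
  -- cancels `q (s₀ w)`.
  set s : residualSpace τ →ₗ[F] V := s₀ + (residualSpace τ).subtype ∘ₗ h
  have hs : ∀ w, s w = s₀ w + h w := fun w => rfl
  have hds : ∀ w, d (s w) = w := fun w => by
    have : d (h w : V) = 0 := Subtype.ext (by rw [← hd, hfix, sub_self]; rfl)
    rw [hs, map_add, hs₀, this, add_zero]
  have hqs : ∀ w, q (s w) = wallForm τ (h w) (h w) := fun w => by
    rw [hs, QuadraticMap.map_add q, QuadraticMap.polar_comm,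
      ← wallForm_eq_polar (h w) w (by rw [hd, hs₀]), hh, hγ, wallForm_self, add_right_comm,
      CharTwo.add_self_eq_zero, zero_add]
  have hdτ : ∀ v, d (τ v) = d v := fun v => Subtype.ext (by
    rw [← hd, ← hd, hτ, ← sub_eq_zero, ← hV (v - τ v)]
    abel)
  have hp : ∀ v, v - s (d v) ∈ residualSpace τ := fun v => by
    have : ((d (v - s (d v)) : residualSpace τ) : V) = 0 := by
      rw [map_sub, hds, sub_self]; rfl
    rw [← hd, sub_eq_zero] at this
    exact (hmem _).2 this
  set p : V →ₗ[F] residualSpace τ := (LinearMap.id - s ∘ₗ d).codRestrict _ hp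
  have hpv : ∀ v, (p v : V) = v - s (d v) := fun v => rfl
  refine ⟨p, d, h, fun v => Subtype.ext ?_, hdτ, fun v => ?_⟩
  · rw [Submodule.coe_add, hpv, hpv, hdτ, ← hd]
    abel
  · have hv : v = p v + s (d v) := by rw [hpv, sub_add_cancel]
    conv_lhs => rw [hv]
    rw [QuadraticMap.map_add q, hqs, wallForm_self (p v),
      ← wallForm_eq_polar (p v) (d v) (by rw [hd, hds])]

theorem isomorphic_of_hasTransposeRep [CharP F 2] [FiniteDimensional F V] {n : ℕ}
    (hn : finrank F V = 2 * n) (hq : IsQuadraticSpace q) (hτ : ∀ x, τ (τ x) = x)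
    (h : HasTransposeRep q τ (Fin (2 ^ n))) :
    (cliffordInvolution τ hτ).Isomorphic (transposeInvolution F (2 ^ n)) := by
  obtain ⟨f, h1, h2⟩ := h
  refine ⟨AlgEquiv.ofBijective (CliffordAlgebra.lift q ⟨f, h1⟩) (lift_bijective hq f h1 ?_),
    fun a => ?_⟩
  · rw [finrank_matrix, finrank_self, hn]
    simp [two_mul, pow_add]
  · change CliffordAlgebra.lift q ⟨f, h1⟩ _ = (CliffordAlgebra.lift q ⟨f, h1⟩ a).transpose
    induction a using CliffordAlgebra.induction with
    | algebraMap r => simp [cliffordInvolution, Matrix.algebraMap_eq_diagonal]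
    | ι v => simp [cliffordInvolution_ι, h2]
    | mul a b ha hb =>
      rw [(cliffordInvolution τ hτ).anti_mul, map_mul, map_mul, ha, hb, Matrix.transpose_mul]
    | add a b ha hb => rw [map_add, map_add, map_add, ha, hb, Matrix.transpose_add]

/-- By symmetry of `M`, the first diagonal entry of `M * M` is the sum of the squares of the first
row, which is the square of that row's sum. -/
theorem isSquare_of_isomorphic [CharP F 2] (hτ : ∀ x, τ (τ x) = x) {m : ℕ} (hm : 0 < m)
    (h : (cliffordInvolution τ hτ).Isomorphic (transposeInvolution F m)) {x : V}
    (hx : τ x = x) : IsSquare (q x) := by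
  obtain ⟨f, hf⟩ := h
  set M := f (CliffordAlgebra.ι q x)
  have hM : M.transpose = M := by
    have := hf (CliffordAlgebra.ι q x)
    rw [cliffordInvolution_ι, hx] at this
    exact this.symm
  have hM2 : M * M = algebraMap F _ (q x) := by
    rw [← map_mul, CliffordAlgebra.ι_sq_scalar, AlgEquiv.commutes]
  have h0 := congrFun (congrFun hM2 ⟨0, hm⟩) ⟨0, hm⟩
  rw [Matrix.mul_apply, Matrix.algebraMap_matrix_apply, if_pos rfl] at h0
  refine ⟨∑ j, M ⟨0, hm⟩ j, ?_⟩
  rw [CharTwo.sum_mul_self]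
  refine h0.symm.trans (Finset.sum_congr rfl fun j _ => ?_)
  exact congrArg (M ⟨0, hm⟩ j * ·) (congrFun (congrFun hM ⟨0, hm⟩) j)

theorem hasTransposeRep_of_orthonormal [CharP F 2] [FiniteDimensional F V]
    (hq : IsQuadraticSpace q) (hτ : ∀ x, τ (τ x) = x) (hrk : residualSpace τ = fixedSpace τ)
    {n : ℕ} (h : (wallForm τ).Equivalent (copies n (rankOne (1 : F)))) :
    HasTransposeRep q τ (Fin (2 ^ n)) := by
  obtain ⟨θ⟩ := h
  have hθ : ∀ u w, wallForm τ u w = ∑ i, θ u i * θ w i := fun u w => by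
    rw [← θ.map_app, copies_apply]
    simp [rankOne_apply]
  obtain ⟨p, d, h, hp, hd, hpd⟩ := exists_decomposition hq hτ hrk
  -- In orthonormal coordinates `ω(h w, h w)` is a sum of squares, hence the square of the linear
  -- form `L`, hence diagonal in `w`. This lets `q` split into planes with constants `L(eᵢ)²`.
  set L : (Fin n → F) →ₗ[F] F :=
    (∑ i, LinearMap.proj i) ∘ₗ (θ : residualSpace τ →ₗ[F] Fin n → F) ∘ₗ h ∘ₗ
      (θ.symm : (Fin n → F) →ₗ[F] residualSpace τ)
  have hL : ∀ w, wallForm τ (h w) (h w) = ∑ i, L (Pi.single i 1) ^ 2 * θ w i ^ 2 := fun w => by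
    have h1 : L (θ w) = ∑ i, θ (h w) i := by
      have : θ.symm (θ w) = w := θ.toLinearEquiv.symm_apply_apply w
      simp [L, this]
    rw [hθ, ← CharTwo.sum_mul_self, ← h1, ← sq, LinearMap.pi_apply_eq_sum_univ L, CharTwo.sum_sq]
    refine Finset.sum_congr rfl fun i _ => ?_
    rw [smul_eq_mul, mul_pow, mul_comm]
    congr 3
    ext j
    simp [Pi.single_apply, eq_comm]
  refine (HasTransposeRep.pi n fun i => hasTransposeRep_two (L (Pi.single i 1) ^ 2)).comp
    (LinearMap.pi fun i => (LinearMap.proj i ∘ₗ (θ : residualSpace τ →ₗ[F] Fin n → F) ∘ₗ p).prod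
      (LinearMap.proj i ∘ₗ (θ : residualSpace τ →ₗ[F] Fin n → F) ∘ₗ d)) (fun v => ?_)
    (fun v => ?_)
  · rw [hpd, hL, hθ, hθ, ← Finset.sum_add_distrib, ← Finset.sum_add_distrib]
    simp [sq]
  · ext i <;> simp [hp, hd]

/-- Here `ω_τ` is alternating, so both diagonal terms of the decomposition vanish and `q v = ω_τ(p
v, d v)` splits into four-dimensional blocks. -/
theorem hasTransposeRep_of_hyperbolic [CharP F 2] [FiniteDimensional F V]
    (hq : IsQuadraticSpace q) (hτ : ∀ x, τ (τ x) = x) (hrk : residualSpace τ = fixedSpace τ)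
    {m : ℕ} (h : (wallForm τ).Equivalent (copies m (hyperbolicPlane (-1 : F)))) :
    HasTransposeRep q τ (Fin (2 ^ (2 * m))) := by
  obtain ⟨θ⟩ := h
  have hθ : ∀ u w, wallForm τ u w =
      ∑ i, ((θ u i).1 * (θ w i).2 + (θ u i).2 * (θ w i).1) := fun u w => by
    rw [← θ.map_app, copies_apply]
    simp [hyperbolicPlane_apply, CharTwo.neg_eq]
  have hself : ∀ u, wallForm τ u u = 0 := fun u => by
    rw [hθ]
    exact Finset.sum_eq_zero fun i _ => by rw [mul_comm, CharTwo.add_self_eq_zero]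
  obtain ⟨p, d, h, hp, hd, hpd⟩ := exists_decomposition hq hτ hrk
  refine ((HasTransposeRep.pi m fun _ => hasTransposeRep_four).comp
    (LinearMap.pi fun i =>
      (LinearMap.proj i ∘ₗ (θ : residualSpace τ →ₗ[F] Fin m → F × F) ∘ₗ p).prod
        (LinearMap.proj i ∘ₗ (θ : residualSpace τ →ₗ[F] Fin m → F × F) ∘ₗ d)) (fun v => ?_)
    (fun v => ?_)).reindex (finCongr (by rw [pow_mul]; norm_num))
  · rw [hpd, hself, hself, hθ]
    simp
  · ext i <;> simp [hp, hd]

end Wall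
end WallForm

theorem mainTheorem3 {F : Type*} [Field F] [CharP F 2] {V : Type*} [AddCommGroup V] [Module F V]
    [FiniteDimensional F V] (n : ℕ) (hn : Module.finrank F V = 2 * n)
    (q : QuadraticForm F V) (hq : WallForm.IsQuadraticSpace q)
    (τ : q.IsometryEquiv q) (hτ : ∀ x, τ (τ x) = x)
    (hrk : WallForm.residualSpace τ = WallForm.fixedSpace τ) :
    List.TFAE [
      (WallForm.cliffordInvolution τ hτ).Isomorphic (WallForm.transposeInvolution F (2 ^ n)),
      ∀ x ∈ WallForm.residualSpace τ, IsSquare (q x),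
      ∀ x : WallForm.residualSpace τ, IsSquare (WallForm.wallForm τ x x),
      (∃ m : ℕ, n = 2 * m ∧
          (WallForm.wallForm τ).Equivalent
            (WallForm.copies m (WallForm.hyperbolicPlane (-1 : F)))) ∨
        (WallForm.wallForm τ).Equivalent (WallForm.copies n (WallForm.rankOne (1 : F)))] := by
  tfae_have 1 → 2 := fun h x hx =>
    WallForm.isSquare_of_isomorphic hτ (by positivity) h (by rw [hrk] at hx; exact hx)
  tfae_have 2 → 3 := fun h x => by
    rw [WallForm.wallForm_self]
    exact h x x.2
  tfae_have 3 → 4 := fun h =>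
    WallForm.equivalent_hyperbolic_or_orthonormal (WallForm.wallForm_symm hτ)
      (WallForm.wallForm_separatingLeft hq) h (WallForm.finrank_residualSpace hn hrk)
  tfae_have 4 → 1 := fun h => by
    refine WallForm.isomorphic_of_hasTransposeRep hn hq hτ ?_
    rcases h with ⟨m, rfl, h⟩ | h
    · exact WallForm.hasTransposeRep_of_hyperbolic hq hτ hrk h
    · exact WallForm.hasTransposeRep_of_orthonormal hq hτ hrk h
  tfae_finish
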